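/- Let $R$ be a commutative ring with a derivation $D_R$. A differential Azumaya $R$-algebra is an Azumaya $R$-algebra $A$ with a derivation $D_A$ extending $D_R$; isomorphisms of such algebras are $R$-algebra isomorphisms commuting with the derivations, and $A\otimes_R B$ carries the derivation $D_A\otimes 1+1\otimes D_B$. For a commutative monoid $M$ and a submonoid $N$, let $M/N$ be the monoid of equivalence classes of $M$ under $m_1\sim m_2$ if and only if $m_1n_1=m_2n_2$ for some $n_1,n_2\in N$. Let $MA(R)$ (respectively $MA^{\mathrm{diff}}(R)$) be the commutative monoid of isomorphism classes of Azumaya (respectively differential Azumaya) $R$-algebras under $\otimes_R$, with identity the class of $R$. Let $MM(R)\subseteq MA(R)$ be the submonoid of classes of the matrix algebras $M_n(R)$, $n\ge 1$. For $Z\in M_n(R)$ let $(M_n(R),Z)$ denote $M_n(R)$ with the derivation $Y\mapsto Y'+ZY-YZ$, where $Y'$ is the entrywise derivative; let $MM^{\mathrm{diff}}(R)\subseteq MA^{\mathrm{diff}}(R)$ be the submonoid of classes of all $(M_n(R),Z)$, and $MM_0^{\mathrm{diff}}(R)$ the submonoid of classes of the $(M_n(R),0)$, $n\geq 1$. Put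 $$BM(R)=MA(R)/MM(R),\qquad BM^{\mathrm{diff}}(R)=MA^{\mathrm{diff}}(R)/MM_0^{\mathrm{diff}}(R),\qquad MBM^{\mathrm{diff}}(R)=MM^{\mathrm{diff}}(R)/MM_0^{\mathrm{diff}}(R),$$ the last being regarded as a submonoid of $BM^{\mathrm{diff}}(R)$ (the image of $MM^{\mathrm{diff}}(R)$). Theorem. The monoid homomorphism $BM^{\mathrm{diff}}(R)\to BM(R)$ induced by forgetting derivations is surjective, and it induces an isomorphism of monoids $$BM^{\mathrm{diff}}(R)/MBM^{\mathrm{diff}}(R)\;\xrightarrow{\ \cong\ }\;BM(R).$$ -/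

import Mathlib

universe u

open scoped TensorProduct

noncomputable section

namespace DiffBrauer

/-! ### Quotients of commutative monoids by submonoids -/

/-- For a submonoid `N` of a commutative monoid `M`: the congruence on `M` with
`m₁ ∼ m₂` iff `m₁ * n₁ = m₂ * n₂` for some `n₁ n₂ ∈ N`. -/
def quotCon {M : Type*} [CommMonoid M] (N : Submonoid M) : Con M where
  r m₁ m₂ := ∃ n₁ ∈ N, ∃ n₂ ∈ N, m₁ * n₁ = m₂ * n₂
  iseqv :=
    { refl := fun _ => ⟨1, N.one_mem, 1, N.one_mem, rfl⟩
      symm := fun ⟨a, ha, b, hb, h⟩ => ⟨b, hb, a, ha, h.symm⟩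
      trans := by
        rintro x y z ⟨a, ha, b, hb, h⟩ ⟨c, hc, d, hd, h'⟩
        refine ⟨a * c, N.mul_mem ha hc, d * b, N.mul_mem hd hb, ?_⟩
        rw [← mul_assoc, h, mul_right_comm, h', mul_assoc] }
  mul' := by
    rintro w x y z ⟨a, ha, b, hb, h⟩ ⟨c, hc, d, hd, h'⟩
    refine ⟨a * c, N.mul_mem ha hc, b * d, N.mul_mem hb hd, ?_⟩
    rw [mul_mul_mul_comm, h, h', mul_mul_mul_comm]

/-- The quotient monoid `M/N`. -/
abbrev MonoidQuot {M : Type*} [CommMonoid M] (N : Submonoid M) : Type _ := (quotCon N).Quotient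

/-- The projection `M → M/N`. -/
abbrev MonoidQuot.mk {M : Type*} [CommMonoid M] (N : Submonoid M) : M →* MonoidQuot N :=
  (quotCon N).mk'

/-- The homomorphism `M/N → M'/N'` induced by a homomorphism `M → M'` that maps `N` into `N'`. -/
def MonoidQuot.map {M M' : Type*} [CommMonoid M] [CommMonoid M'] (N : Submonoid M)
    (N' : Submonoid M') (f : M →* M') (hf : ∀ n ∈ N, f n ∈ N') : MonoidQuot N →* MonoidQuot N' :=
  (quotCon N).lift ((MonoidQuot.mk N').comp f) (by
    rintro x y ⟨a, ha, b, hb, h⟩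
    exact (Con.eq _).2 ⟨f a, hf a ha, f b, hf b hb, by rw [← map_mul, ← map_mul, h]⟩)

/-! ### Tensor products of Azumaya algebras -/

section Azumaya

variable {R A B : Type*} [CommRing R]

/-- For finitely generated projective modules, `End A ⊗ End B → End (A ⊗ B)` is bijective. -/
theorem homTensorHomMap_bijective [AddCommGroup A] [Module R A] [AddCommGroup B] [Module R B]
    [Module.Finite R A] [Module.Projective R A] [Module.Finite R B] [Module.Projective R B] :
    Function.Bijective (TensorProduct.homTensorHomMap (RingHom.id R) A B A B) := by
  obtain ⟨n, f, g, -, -, hfg⟩ := Module.Finite.exists_comp_eq_id_of_projective R A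
  obtain ⟨m, f', g', -, -, hfg'⟩ := Module.Finite.exists_comp_eq_id_of_projective R B
  have hA : ∀ a : A, ∑ i, g a i • f (Pi.single i 1) = a := by
    intro a
    have := LinearMap.congr_fun hfg a
    rw [LinearMap.comp_apply, LinearMap.id_apply] at this
    refine Eq.trans ?_ this
    conv_rhs => rw [pi_eq_sum_univ' (g a), map_sum]
    refine Finset.sum_congr rfl fun i _ => ?_
    rw [map_smul]
  have hB : ∀ b : B, ∑ i, g' b i • f' (Pi.single i 1) = b := by
    intro b
    have := LinearMap.congr_fun hfg' b
    rw [LinearMap.comp_apply, LinearMap.id_apply] at this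
    refine Eq.trans ?_ this
    conv_rhs => rw [pi_eq_sum_univ' (g' b), map_sum]
    refine Finset.sum_congr rfl fun i _ => ?_
    rw [map_smul]
  let p : Fin n → A →ₗ[R] Module.End R A := fun i =>
    LinearMap.smulRightₗ ((LinearMap.proj i).comp g)
  let q : Fin m → B →ₗ[R] Module.End R B := fun j =>
    LinearMap.smulRightₗ ((LinearMap.proj j).comp g')
  let inv : Module.End R (A ⊗[R] B) → Module.End R A ⊗[R] Module.End R B := fun φ =>
    ∑ i, ∑ j, TensorProduct.map (p i) (q j) (φ (f (Pi.single i 1) ⊗ₜ f' (Pi.single j 1)))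
  have hp : ∀ u : Module.End R A, ∑ i, p i (u (f (Pi.single i 1))) = u := by
    intro u
    ext a
    simp only [p, LinearMap.sum_apply, LinearMap.smulRightₗ_apply]
    conv_rhs => rw [← hA a, map_sum]
    simp
  have hq : ∀ u : Module.End R B, ∑ i, q i (u (f' (Pi.single i 1))) = u := by
    intro u
    ext a
    simp only [q, LinearMap.sum_apply, LinearMap.smulRightₗ_apply]
    conv_rhs => rw [← hB a, map_sum]
    simp
  refine Function.bijective_iff_has_inverse.2 ⟨inv, ?_, ?_⟩
  · intro t
    induction t with
    | zero => simp [inv]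
    | add x y hx hy =>
      conv_rhs => rw [← hx, ← hy]
      simp [inv, Finset.sum_add_distrib]
    | tmul u v =>
      simp only [inv, TensorProduct.homTensorHomMap_apply, TensorProduct.map_tmul]
      simp_rw [← TensorProduct.tmul_sum, ← TensorProduct.sum_tmul]
      rw [hp, hq]
  · intro φ
    have key : ∀ i j (z : A ⊗[R] B) (a : A) (b : B),
        TensorProduct.homTensorHomMap (RingHom.id R) A B A B
          (TensorProduct.map (p i) (q j) z) (a ⊗ₜ b) = (g a i * g' b j) • z := by
      intro i j z a b
      induction z with
      | zero => simp
      | add x y hx hy => simp [hx, hy]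
      | tmul x y =>
        simp [p, q, ← TensorProduct.smul_tmul', smul_smul, mul_comm]
    apply TensorProduct.ext'
    intro a b
    simp only [inv, map_sum, LinearMap.sum_apply, key]
    conv_rhs => rw [← hA a, ← hB b]
    simp only [TensorProduct.tmul_sum, TensorProduct.sum_tmul, map_sum,
      TensorProduct.smul_tmul_smul, map_smul]
    rw [Finset.sum_comm]

theorem isAzumaya_tensor [Ring A] [Algebra R A] [Ring B] [Algebra R B]
    [hA : IsAzumaya R A] [hB : IsAzumaya R B] : IsAzumaya R (A ⊗[R] B) where
  toFaithfulSMul := by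
    rw [faithfulSMul_iff_algebraMap_injective]
    have h1 : Function.Injective (algebraMap R A) := FaithfulSMul.algebraMap_injective R A
    have h2 : Function.Injective (algebraMap R B) := FaithfulSMul.algebraMap_injective R B
    have h3 := Algebra.TensorProduct.includeRight_injective (R := R) (A := A) (B := B) h1
    have : (algebraMap R (A ⊗[R] B) : R → A ⊗[R] B) =
        (Algebra.TensorProduct.includeRight : B →ₐ[R] A ⊗[R] B) ∘ algebraMap R B := by
      ext r
      simp
    rw [this]
    exact h3.comp h2
  bij := by
    let e := (Algebra.TensorProduct.congr (AlgEquiv.refl : (A ⊗[R] B) ≃ₐ[R] (A ⊗[R] B))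
        (Algebra.TensorProduct.opAlgEquiv R R A B).symm).trans
      (Algebra.TensorProduct.tensorTensorTensorComm R R R R A B Aᵐᵒᵖ Bᵐᵒᵖ)
    have h1 : Function.Bijective (TensorProduct.map (AlgHom.mulLeftRight R A).toLinearMap
        (AlgHom.mulLeftRight R B).toLinearMap) :=
      TensorProduct.map_bijective hA.bij hB.bij
    have h := (homTensorHomMap_bijective (R := R) (A := A) (B := B)).comp (h1.comp e.bijective)
    convert h using 1
    have : (AlgHom.mulLeftRight R (A ⊗[R] B)).toLinearMap =
        (TensorProduct.homTensorHomMap (RingHom.id R) A B A B).comp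
          ((TensorProduct.map (AlgHom.mulLeftRight R A).toLinearMap
            (AlgHom.mulLeftRight R B).toLinearMap).comp e.toLinearMap) := by
      apply TensorProduct.ext'
      intro x y
      induction x with
      | zero => simp
      | add x x' hx hx' => rw [TensorProduct.add_tmul, map_add, map_add, hx, hx']
      | tmul a b =>
        induction y using MulOpposite.rec' with
        | _ y =>
        induction y with
        | zero => simp
        | add y y' hy hy' =>
          rw [MulOpposite.op_add, TensorProduct.tmul_add, map_add, map_add, hy, hy']
        | tmul c d =>
          apply TensorProduct.ext'
          intro s t
          simp [e]
    exact congrArg DFunLike.coe this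

end Azumaya

/-! ### Differential algebras -/

/-- `D` makes the (not necessarily commutative) `R`-algebra `A` a differential `R`-algebra:
it is a derivation of `A` that extends the derivation of the differential ring `R`. -/
structure IsDiffAlg (R : Type*) [CommRing R] [Differential R] {A : Type*} [Ring A] [Algebra R A]
    (D : A →+ A) : Prop where
  leibniz : ∀ a b : A, D (a * b) = D a * b + a * D b
  map_algebraMap : ∀ r : R, D (algebraMap R A r) = algebraMap R A (Differential.deriv r)

section Derivations

variable {R : Type*} [CommRing R] [Differential R]

theorem IsDiffAlg.map_smul {A : Type*} [Ring A] [Algebra R A] {D : A →+ A} (h : IsDiffAlg R D)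
    (r : R) (a : A) : D (r • a) = (Differential.deriv r : R) • a + r • D a := by
  rw [Algebra.smul_def, h.leibniz, h.map_algebraMap, ← Algebra.smul_def, ← Algebra.smul_def]

variable {A B : Type*} [Ring A] [Algebra R A] [Ring B] [Algebra R B]

/-- The derivation `D_A ⊗ 1 + 1 ⊗ D_B` of `A ⊗[R] B`. -/
def tensorDeriv {D : A →+ A} {E : B →+ B} (hD : IsDiffAlg R D) (hE : IsDiffAlg R E) :
    A ⊗[R] B →+ A ⊗[R] B :=
  TensorProduct.liftAddHom
    (AddMonoidHom.mk' (fun a => AddMonoidHom.mk' (fun b => D a ⊗ₜ[R] b + a ⊗ₜ[R] E b)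
        (fun b b' => by simp only [map_add, TensorProduct.tmul_add]; abel))
      (fun a a' => by
        ext b
        simp only [map_add, TensorProduct.add_tmul, AddMonoidHom.mk'_apply,
          AddMonoidHom.add_apply]
        abel))
    (fun r a b => by
      simp only [AddMonoidHom.mk'_apply, hD.map_smul, hE.map_smul, TensorProduct.add_tmul,
        TensorProduct.tmul_add, TensorProduct.smul_tmul]
      abel)

@[simp]
theorem tensorDeriv_tmul {D : A →+ A} {E : B →+ B} (hD : IsDiffAlg R D) (hE : IsDiffAlg R E)
    (a : A) (b : B) : tensorDeriv hD hE (a ⊗ₜ b) = D a ⊗ₜ[R] b + a ⊗ₜ[R] E b := rfl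

theorem isDiffAlg_tensor {D : A →+ A} {E : B →+ B} (hD : IsDiffAlg R D) (hE : IsDiffAlg R E) :
    IsDiffAlg R (tensorDeriv hD hE) where
  leibniz x y := by
    induction x with
    | zero => simp
    | add x x' hx hx' => simp only [add_mul, map_add, hx, hx']; abel
    | tmul a b =>
      induction y with
      | zero => simp
      | add y y' hy hy' => simp only [mul_add, map_add, hy, hy']; abel
      | tmul c d =>
        simp only [Algebra.TensorProduct.tmul_mul_tmul, tensorDeriv_tmul, hD.leibniz, hE.leibniz,
          TensorProduct.add_tmul, TensorProduct.tmul_add, add_mul, mul_add]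
        abel
  map_algebraMap r := by
    have h1 : E 1 = 0 := by simpa using hE.map_algebraMap 1
    rw [Algebra.TensorProduct.algebraMap_apply, tensorDeriv_tmul, h1, TensorProduct.tmul_zero,
      add_zero, hD.map_algebraMap, Algebra.TensorProduct.algebraMap_apply]

theorem isDiffAlg_self : IsDiffAlg R (Differential.deriv (R := R) : R →+ R) where
  leibniz a b := by
    simp [mul_comm, add_comm]
  map_algebraMap r := rfl

/-- The derivation `∂_Z : Y ↦ Y′ + Z Y - Y Z` of the matrix algebra, `Y′` being the
entrywise derivative. -/
def matrixDeriv {n : Type*} [Fintype n] (Z : Matrix n n R) : Matrix n n R →+ Matrix n n R :=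
  AddMonoidHom.mk' (fun Y => Y.map (fun r => (Differential.deriv r : R)) + Z * Y - Y * Z)
    (fun Y Y' => by
      rw [Matrix.map_add _ (fun a b => map_add _ a b), mul_add, add_mul]
      abel)

theorem matrixDeriv_apply {n : Type*} [Fintype n] (Z Y : Matrix n n R) :
    matrixDeriv Z Y = Y.map (fun r => (Differential.deriv r : R)) + Z * Y - Y * Z := rfl

theorem isDiffAlg_matrix {n : Type*} [Fintype n] [DecidableEq n] (Z : Matrix n n R) :
    IsDiffAlg R (matrixDeriv Z) where
  leibniz X Y := by
    have : (X * Y).map (fun r => (Differential.deriv r : R)) =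
        X.map (fun r => (Differential.deriv r : R)) * Y +
          X * Y.map (fun r => (Differential.deriv r : R)) := by
      ext i j
      simp only [Matrix.map_apply, Matrix.mul_apply, Matrix.add_apply, map_sum,
        Derivation.leibniz, smul_eq_mul, Finset.sum_add_distrib]
      rw [add_comm]
      congr 1
      exact Finset.sum_congr rfl fun _ _ => mul_comm _ _
    simp only [matrixDeriv_apply, this]
    noncomm_ring
  map_algebraMap r := by
    rw [matrixDeriv_apply, Algebra.commutes r Z, add_sub_cancel_right]
    ext i j
    simp only [Matrix.map_apply, Matrix.algebraMap_matrix_apply]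
    split_ifs <;> simp

end Derivations

/-! ### Azumaya algebras and the monoid `MA(R)` -/

variable (R : Type u) [CommRing R]

/-- Azumaya algebras over `R`. They are finitely generated modules, so that up to isomorphism
all of them lie in the universe of `R`. -/
structure AzumayaAlg : Type (u + 1) where
  carrier : Type u
  [ring : Ring carrier]
  [algebra : Algebra R carrier]
  [isAzumaya : IsAzumaya R carrier]

attribute [instance] AzumayaAlg.ring AzumayaAlg.algebra AzumayaAlg.isAzumaya

/-- Isomorphism of Azumaya algebras. -/
instance azumayaSetoid : Setoid (AzumayaAlg R) where
  r A B := Nonempty (A.carrier ≃ₐ[R] B.carrier)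
  iseqv :=
    { refl := fun _ => ⟨AlgEquiv.refl⟩
      symm := fun ⟨e⟩ => ⟨e.symm⟩
      trans := fun ⟨e⟩ ⟨f⟩ => ⟨e.trans f⟩ }

/-- `MA(R)`: the isomorphism classes of Azumaya `R`-algebras. -/
def MA : Type (u + 1) := Quotient (azumayaSetoid R)

variable {R}

/-- The tensor product of Azumaya algebras. -/
def AzumayaAlg.tensor (A B : AzumayaAlg R) : AzumayaAlg R :=
  { carrier := A.carrier ⊗[R] B.carrier
    isAzumaya := isAzumaya_tensor }

variable (R) in
/-- `R` as an Azumaya algebra over itself. -/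
def AzumayaAlg.base : AzumayaAlg R := { carrier := R }

variable (R) in
/-- The matrix algebra `M_n(R)`, `n ≥ 1`. -/
def AzumayaAlg.matrix (n : ℕ) [NeZero n] : AzumayaAlg R :=
  { carrier := Matrix (Fin n) (Fin n) R
    isAzumaya := IsAzumaya.matrix R (Fin n) }

/-- The isomorphism class of an Azumaya algebra. -/
def MA.mk (A : AzumayaAlg R) : MA R := Quotient.mk (azumayaSetoid R) A

theorem MA.mk_eq_mk {A B : AzumayaAlg R} :
    MA.mk A = MA.mk B ↔ Nonempty (A.carrier ≃ₐ[R] B.carrier) := Quotient.eq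

/-- The operation of `MA(R)` is induced by the tensor product, the identity is the class of `R`. -/
instance MA.commMonoid : CommMonoid (MA R) where
  mul := Quotient.map₂ AzumayaAlg.tensor
    (fun _ _ ⟨e⟩ _ _ ⟨f⟩ => ⟨Algebra.TensorProduct.congr e f⟩)
  one := MA.mk (AzumayaAlg.base R)
  mul_assoc := by
    rintro ⟨A⟩ ⟨B⟩ ⟨C⟩
    exact Quotient.sound
      ⟨Algebra.TensorProduct.assoc R R R A.carrier B.carrier C.carrier⟩
  one_mul := by
    rintro ⟨A⟩
    exact Quotient.sound ⟨Algebra.TensorProduct.lid R A.carrier⟩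
  mul_one := by
    rintro ⟨A⟩
    exact Quotient.sound ⟨Algebra.TensorProduct.rid R R A.carrier⟩
  mul_comm := by
    rintro ⟨A⟩ ⟨B⟩
    exact Quotient.sound ⟨Algebra.TensorProduct.comm R A.carrier B.carrier⟩

theorem MA.mk_mul_mk (A B : AzumayaAlg R) : MA.mk A * MA.mk B = MA.mk (A.tensor B) := rfl

theorem MA.one_def : (1 : MA R) = MA.mk (AzumayaAlg.base R) := rfl

variable (R) in
/-- `M_m(R) ⊗ M_n(R) ≅ M_{mn}(R)`. -/
def matrixTensorEquiv (m n : ℕ) : Matrix (Fin m) (Fin m) R ⊗[R] Matrix (Fin n) (Fin n) R ≃ₐ[R]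
    Matrix (Fin (m * n)) (Fin (m * n)) R :=
  (Matrix.kroneckerAlgEquiv (Fin m) (Fin n) R).trans
    (Matrix.reindexAlgEquiv R R finProdFinEquiv)

/-- `R ≅ M_1(R)`. -/
def matrixOneEquiv : R ≃ₐ[R] Matrix (Fin 1) (Fin 1) R :=
  AlgEquiv.ofBijective (Algebra.ofId R _) (by
    constructor
    · intro r s h
      simpa [Algebra.ofId_apply, Matrix.algebraMap_matrix_apply] using congrFun (congrFun h 0) 0
    · intro M
      refine ⟨M 0 0, ?_⟩
      ext i j
      rw [Subsingleton.elim i 0, Subsingleton.elim j 0]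
      simp [Algebra.ofId_apply, Matrix.algebraMap_matrix_apply])

variable (R) in
/-- `MM(R)`: the submonoid of `MA(R)` of the classes of matrix algebras. -/
def MM : Submonoid (MA R) where
  carrier := {x | ∃ (n : ℕ) (_ : NeZero n), x = MA.mk (AzumayaAlg.matrix R n)}
  one_mem' := ⟨1, inferInstance, MA.mk_eq_mk.2 ⟨matrixOneEquiv⟩⟩
  mul_mem' := by
    rintro _ _ ⟨m, _, rfl⟩ ⟨n, _, rfl⟩
    exact ⟨m * n, inferInstance, MA.mk_eq_mk.2 ⟨matrixTensorEquiv R m n⟩⟩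

variable (R) in
/-- `BM(R) = MA(R)/MM(R)`, the Brauer monoid of `R`. -/
abbrev BM : Type (u + 1) := MonoidQuot (MM R)

/-! ### Differential Azumaya algebras and the monoid `MA^diff(R)` -/

variable (R) [Differential R]

/-- Differential Azumaya algebras over the differential ring `R`. -/
structure DiffAzumayaAlg : Type (u + 1) extends AzumayaAlg R where
  D : carrier →+ carrier
  isDiffAlg : IsDiffAlg R D

variable {R}

/-- Isomorphisms of differential `R`-algebras exist between `A` and `B`. -/
def DiffIso (A B : DiffAzumayaAlg R) : Prop :=
  ∃ e : A.carrier ≃ₐ[R] B.carrier, ∀ a, e (A.D a) = B.D (e a)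

variable (R) in
/-- Isomorphism of differential Azumaya algebras. -/
instance diffAzumayaSetoid : Setoid (DiffAzumayaAlg R) where
  r := DiffIso
  iseqv :=
    { refl := fun _ => ⟨AlgEquiv.refl, fun _ => rfl⟩
      symm := fun ⟨e, h⟩ => ⟨e.symm, fun b => by rw [e.symm_apply_eq, h, e.apply_symm_apply]⟩
      trans := fun ⟨e, h⟩ ⟨f, k⟩ => ⟨e.trans f, fun a => by
        rw [AlgEquiv.trans_apply, AlgEquiv.trans_apply, h, k]⟩ }

variable (R) in
/-- `MA^diff(R)`: the isomorphism classes of differential Azumaya `R`-algebras. -/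
def MAdiff : Type (u + 1) := Quotient (diffAzumayaSetoid R)

/-- The tensor product of differential Azumaya algebras. -/
def DiffAzumayaAlg.tensor (A B : DiffAzumayaAlg R) : DiffAzumayaAlg R :=
  { A.toAzumayaAlg.tensor B.toAzumayaAlg with
    D := tensorDeriv A.isDiffAlg B.isDiffAlg
    isDiffAlg := isDiffAlg_tensor A.isDiffAlg B.isDiffAlg }

variable (R) in
/-- `R` as a differential Azumaya algebra over itself. -/
def DiffAzumayaAlg.base : DiffAzumayaAlg R :=
  { AzumayaAlg.base R with
    D := (Differential.deriv (R := R) : R →+ R)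
    isDiffAlg := isDiffAlg_self }

/-- The differential matrix algebra `(M_n(R), Z)`, `n ≥ 1`. -/
def DiffAzumayaAlg.matrix (n : ℕ) [NeZero n] (Z : Matrix (Fin n) (Fin n) R) : DiffAzumayaAlg R :=
  { AzumayaAlg.matrix R n with
    D := matrixDeriv Z
    isDiffAlg := isDiffAlg_matrix Z }

/-- The isomorphism class of a differential Azumaya algebra. -/
def MAdiff.mk (A : DiffAzumayaAlg R) : MAdiff R := Quotient.mk (diffAzumayaSetoid R) A

theorem MAdiff.mk_eq_mk {A B : DiffAzumayaAlg R} : MAdiff.mk A = MAdiff.mk B ↔ DiffIso A B :=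
  Quotient.eq

theorem DiffIso.tensor {A A' B B' : DiffAzumayaAlg R} (h : DiffIso A A') (k : DiffIso B B') :
    DiffIso (A.tensor B) (A'.tensor B') := by
  obtain ⟨e, he⟩ := h
  obtain ⟨f, hf⟩ := k
  refine ⟨Algebra.TensorProduct.congr e f, fun x => ?_⟩
  change A.carrier ⊗[R] B.carrier at x
  change Algebra.TensorProduct.congr e f (tensorDeriv A.isDiffAlg B.isDiffAlg x) =
    tensorDeriv A'.isDiffAlg B'.isDiffAlg (Algebra.TensorProduct.congr e f x)
  induction x with
  | zero => simp
  | add x y hx hy => simp only [map_add, hx, hy]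
  | tmul a b => simp [he, hf]

theorem diffIso_assoc (A B C : DiffAzumayaAlg R) :
    DiffIso ((A.tensor B).tensor C) (A.tensor (B.tensor C)) := by
  let e := Algebra.TensorProduct.assoc R R R A.carrier B.carrier C.carrier
  let hAB := isDiffAlg_tensor A.isDiffAlg B.isDiffAlg
  let hBC := isDiffAlg_tensor B.isDiffAlg C.isDiffAlg
  refine ⟨e, fun x => ?_⟩
  change (A.carrier ⊗[R] B.carrier) ⊗[R] C.carrier at x
  change e (tensorDeriv hAB C.isDiffAlg x) = tensorDeriv A.isDiffAlg hBC (e x)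
  induction x with
  | zero => simp
  | add x y hx hy => simp only [map_add, hx, hy]
  | tmul x c =>
    induction x with
    | zero => simp
    | add x y hx hy => simp only [TensorProduct.add_tmul, map_add, hx, hy]
    | tmul a b =>
      simp only [e, tensorDeriv_tmul, TensorProduct.add_tmul, map_add,
        Algebra.TensorProduct.assoc_tmul, TensorProduct.tmul_add]
      abel

theorem diffIso_base_tensor (A : DiffAzumayaAlg R) :
    DiffIso ((DiffAzumayaAlg.base R).tensor A) A := by
  let e := Algebra.TensorProduct.lid R A.carrier
  refine ⟨e, fun x => ?_⟩
  change R ⊗[R] A.carrier at x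
  change e (tensorDeriv isDiffAlg_self A.isDiffAlg x) = A.D (e x)
  induction x with
  | zero => simp
  | add x y hx hy => simp only [map_add, hx, hy]
  | tmul r a => simp [e, A.isDiffAlg.map_smul]

theorem diffIso_comm (A B : DiffAzumayaAlg R) : DiffIso (A.tensor B) (B.tensor A) := by
  let e := Algebra.TensorProduct.comm R A.carrier B.carrier
  refine ⟨e, fun x => ?_⟩
  change A.carrier ⊗[R] B.carrier at x
  change e (tensorDeriv A.isDiffAlg B.isDiffAlg x) = tensorDeriv B.isDiffAlg A.isDiffAlg (e x)
  induction x with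
  | zero => simp
  | add x y hx hy => simp only [map_add, hx, hy]
  | tmul a b => simp [e, add_comm]

/-- The operation of `MA^diff(R)` is induced by the tensor product, the identity is the class
of `R`. -/
instance MAdiff.commMonoid : CommMonoid (MAdiff R) where
  mul := Quotient.map₂ DiffAzumayaAlg.tensor (fun _ _ h _ _ k => DiffIso.tensor h k)
  one := MAdiff.mk (DiffAzumayaAlg.base R)
  mul_assoc := by
    rintro ⟨A⟩ ⟨B⟩ ⟨C⟩
    exact Quotient.sound (diffIso_assoc A B C)
  one_mul := by
    rintro ⟨A⟩
    exact Quotient.sound (diffIso_base_tensor A)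
  mul_one := by
    rintro ⟨A⟩
    exact Quotient.sound (Setoid.trans (diffIso_comm A _) (diffIso_base_tensor A))
  mul_comm := by
    rintro ⟨A⟩ ⟨B⟩
    exact Quotient.sound (diffIso_comm A B)

theorem MAdiff.mk_mul_mk (A B : DiffAzumayaAlg R) :
    MAdiff.mk A * MAdiff.mk B = MAdiff.mk (A.tensor B) := rfl

theorem MAdiff.one_def : (1 : MAdiff R) = MAdiff.mk (DiffAzumayaAlg.base R) := rfl

theorem diffIso_base_matrix : DiffIso (DiffAzumayaAlg.base R) (DiffAzumayaAlg.matrix 1 0) := by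
  refine ⟨matrixOneEquiv, fun r => ?_⟩
  change R at r
  change matrixOneEquiv (Differential.deriv r) = matrixDeriv 0 (matrixOneEquiv r)
  rw [matrixDeriv_apply, zero_mul, mul_zero, add_zero, sub_zero]
  have h : ∀ s : R, matrixOneEquiv s = algebraMap R (Matrix (Fin 1) (Fin 1) R) s := fun _ => rfl
  ext i j
  rw [Subsingleton.elim i j]
  simp [h, Matrix.algebraMap_matrix_apply]

open scoped Kronecker in
/-- `(M_m(R), Z) ⊗ (M_n(R), W) ≅ (M_{mn}(R), Z ⊗ 1 + 1 ⊗ W)`. -/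
theorem diffIso_matrix_tensor (m n : ℕ) [NeZero m] [NeZero n] (Z : Matrix (Fin m) (Fin m) R)
    (W : Matrix (Fin n) (Fin n) R) :
    DiffIso ((DiffAzumayaAlg.matrix m Z).tensor (DiffAzumayaAlg.matrix n W))
      (DiffAzumayaAlg.matrix (m * n)
        (Matrix.reindexAlgEquiv R R finProdFinEquiv (Z ⊗ₖ 1 + 1 ⊗ₖ W))) := by
  refine ⟨matrixTensorEquiv R m n, fun x => ?_⟩
  change Matrix (Fin m) (Fin m) R ⊗[R] Matrix (Fin n) (Fin n) R at x
  change matrixTensorEquiv R m n (tensorDeriv (isDiffAlg_matrix Z) (isDiffAlg_matrix W) x) =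
    matrixDeriv _ (matrixTensorEquiv R m n x)
  induction x with
  | zero => simp
  | add x y hx hy => simp only [map_add, hx, hy]
  | tmul a b =>
    have h : (matrixDeriv Z a) ⊗ₖ b + a ⊗ₖ (matrixDeriv W b) =
        matrixDeriv (Z ⊗ₖ 1 + 1 ⊗ₖ W) (a ⊗ₖ b) := by
      have hd : (a ⊗ₖ b).map (fun r => (Differential.deriv r : R)) =
          a.map (fun r => (Differential.deriv r : R)) ⊗ₖ b +
            a ⊗ₖ b.map (fun r => (Differential.deriv r : R)) := by
        ext i j
        simp only [Matrix.map_apply, Matrix.kroneckerMap_apply, Matrix.add_apply,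
          Derivation.leibniz, smul_eq_mul]
        ring
      simp only [matrixDeriv_apply, hd, add_mul, mul_add, ← Matrix.mul_kronecker_mul, one_mul,
        mul_one, sub_eq_add_neg, Matrix.add_kronecker, Matrix.kronecker_add]
      have h1 : (-(a * Z)) ⊗ₖ b = -((a * Z) ⊗ₖ b) := by ext; simp
      have h2 : a ⊗ₖ (-(b * W)) = -(a ⊗ₖ (b * W)) := by ext; simp
      rw [h1, h2]
      abel
    have hr : ∀ V Y : Matrix (Fin m × Fin n) (Fin m × Fin n) R,
        Matrix.reindexAlgEquiv R R finProdFinEquiv (matrixDeriv V Y) =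
          matrixDeriv (Matrix.reindexAlgEquiv R R finProdFinEquiv V)
            (Matrix.reindexAlgEquiv R R finProdFinEquiv Y) := by
      intro V Y
      simp only [matrixDeriv_apply, map_add, map_sub, map_mul]
      rfl
    rw [tensorDeriv_tmul, map_add]
    simp only [matrixTensorEquiv, AlgEquiv.trans_apply, Matrix.kroneckerAlgEquiv_apply,
      kroneckerLinearEquiv_tmul]
    rw [← map_add, h, hr]

variable (R) in
/-- `MM^diff(R)`: the submonoid of `MA^diff(R)` of the classes of the `(M_n(R), Z)`. -/
def MMdiff : Submonoid (MAdiff R) where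
  carrier := {x | ∃ (n : ℕ) (_ : NeZero n) (Z : Matrix (Fin n) (Fin n) R),
    x = MAdiff.mk (DiffAzumayaAlg.matrix n Z)}
  one_mem' := ⟨1, inferInstance, 0, MAdiff.mk_eq_mk.2 diffIso_base_matrix⟩
  mul_mem' := by
    rintro _ _ ⟨m, _, Z, rfl⟩ ⟨n, _, W, rfl⟩
    exact ⟨m * n, inferInstance, _, MAdiff.mk_eq_mk.2 (diffIso_matrix_tensor m n Z W)⟩

variable (R) in
/-- `MM₀^diff(R)`: the submonoid of `MA^diff(R)` of the classes of the `(M_n(R), 0)`. -/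
def MM0diff : Submonoid (MAdiff R) where
  carrier := {x | ∃ (n : ℕ) (_ : NeZero n), x = MAdiff.mk (DiffAzumayaAlg.matrix n 0)}
  one_mem' := ⟨1, inferInstance, MAdiff.mk_eq_mk.2 diffIso_base_matrix⟩
  mul_mem' := by
    rintro _ _ ⟨m, _, rfl⟩ ⟨n, _, rfl⟩
    refine ⟨m * n, inferInstance, MAdiff.mk_eq_mk.2 ?_⟩
    simpa using diffIso_matrix_tensor (R := R) m n 0 0

variable (R) in
/-- `BM^diff(R) = MA^diff(R)/MM₀^diff(R)`, the differential Brauer monoid of `R`. -/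
abbrev BMdiff : Type (u + 1) := MonoidQuot (MM0diff R)

variable (R) in
/-- `MBM^diff(R) = MM^diff(R)/MM₀^diff(R)`, the matrix differential Brauer monoid of `R`, as a
submonoid of `BM^diff(R)`: the image of `MM^diff(R)`. (The relation that defines
`MM^diff(R)/MM₀^diff(R)` is the restriction to `MM^diff(R)` of the one that defines
`BM^diff(R)`.) -/
def MBMdiff : Submonoid (BMdiff R) := (MMdiff R).map (MonoidQuot.mk (MM0diff R))

variable (R) in
/-- The homomorphism `MA^diff(R) → MA(R)` that forgets the derivations. -/
def MAdiff.forget : MAdiff R →* MA R where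
  toFun := Quotient.map (fun A => A.toAzumayaAlg) (fun _ _ ⟨e, _⟩ => ⟨e⟩)
  map_one' := rfl
  map_mul' := by
    rintro ⟨A⟩ ⟨B⟩
    rfl

theorem MAdiff.forget_mk (A : DiffAzumayaAlg R) :
    MAdiff.forget R (MAdiff.mk A) = MA.mk A.toAzumayaAlg := rfl

variable (R) in
/-- The homomorphism `BM^diff(R) → BM(R)` induced by forgetting the derivations. -/
def BMdiff.toBM : BMdiff R →* BM R :=
  MonoidQuot.map (MM0diff R) (MM R) (MAdiff.forget R) (by
    rintro _ ⟨n, hn, rfl⟩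
    exact ⟨n, hn, rfl⟩)

end DiffBrauer

end

/-!
The kernel of `BM^diff(R) → BM(R)` is understood through inverses. Suppose that every Azumaya algebra
`A` has a partner `B` with `A ⊗ B ≅ M_N(R)`, that Azumaya algebras carry derivations extending the one
of `R`, and that all such derivations of `M_N(R)` are of the form `Y ↦ Y′ + ZY - YZ`. Let `x` and `y`
be two differential structures on `A`, and `z` one on `B`. Then `x * z` and `y * z` lie in
`MM^diff(R)`, and `x * (y * z) = y * (x * z)` shows that `x` and `y` agree modulo `MM^diff(R)`
(`MAdiff.exists_mul_eq_mul`). The quotients by matrix algebras are then compared formally.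

The partner is `B = Aᵐᵒᵖ ⊗ End Q`, where `Q` is a finitely generated projective module such that
`A ⊗ Q` is free (`AzumayaAlg.exists_tensor_equiv_matrix`). Its existence is a theorem of Bass
(`exists_tensor_equiv_free`), for which the argument avoids dimension theory. If `P` is faithful and
finitely generated projective, then locally there are maps `Rʳ → P → Rʳ` whose composites are
multiplication by `f`, and finitely many such `f` generate the unit ideal. The `ℤ/2`-graded tensor
product of the resulting odd operators has a square equal to the sum of the `f`'s, suitably scaled to
be `1`, so that its even and odd parts are isomorphic. In the semiring of classes of finitely
generated projective modules this is a relation `a + [P] * e = [P] * o` with an integer `a > 0`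
(`exists_natCast_add_eq_mul`). From it an honest module `Q` is extracted by semiring arithmetic
(`exists_mul_eq_natCast`): positivity comes from expanding `1 / x` geometrically in the complement
`n - x`, and stable freeness is improved to freeness by taking multiples.

The derivation on `A` is obtained from the entrywise derivation `D` of `A ⊗ B ≅ M_N(R)` as
`a ↦ (1 ⊗ l) (D (a ⊗ 1))`, where `l : B → R` is linear with `l 1 = 1` (`IsDiffAlg.exists_of_tensor`).
-/

noncomputable section

namespace DiffBrauer

/-! ### Division in a semiring whose elements are bounded by integers -/

section Semiring

variable {S : Type*} [CommSemiring S]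

/-- In the Grothendieck ring of `S` the hypothesis `a + x * e = x * o` makes `x` invertible after
inverting `a`. The content of the lemma is that the inverse is represented, up to an integer factor,
by an actual element of `S`, and that the resulting equality holds in `S` itself, which is not
assumed to be cancellative. -/
theorem exists_mul_eq_natCast (hc : ∀ y : S, ∃ (y' : S) (n : ℕ), y + y' = n) {x e o : S} {a : ℕ}
    (ha : 0 < a) (h : a + x * e = x * o) : ∃ (q : S) (N : ℕ), 0 < N ∧ x * q = N := by
  obtain ⟨b, rfl⟩ : ∃ b, a = b + 1 := ⟨a - 1, by omega⟩
  -- A complement of `e` turns its coefficient into an integer `m`.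
  obtain ⟨e', m, he⟩ := hc e
  obtain ⟨q₀, hq₀⟩ : ∃ q₀ : S, ((b + 1 : ℕ) : S) + x * m = x * q₀ :=
    ⟨o + e', by rw [← he, mul_add, ← add_assoc, h, mul_add]⟩
  -- `y` plays the role of `n - x`; enlarging both makes `n` positive.
  obtain ⟨y, n, hn0, hy⟩ : ∃ (y : S) (n : ℕ), 0 < n ∧ x + y = n := by
    obtain ⟨y, n, hy⟩ := hc x
    exact ⟨y + 1, n + 1, n.succ_pos, by rw [← add_assoc, hy]; push_cast; rfl⟩
  have hpow : ∀ K : ℕ, ∃ z : S, (n : S) ^ K = y ^ K + z := by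
    intro K
    induction K with
    | zero => exact ⟨0, by simp⟩
    | succ K ih =>
      obtain ⟨z, hz⟩ := ih
      refine ⟨y * z + x * n ^ K, ?_⟩
      calc (n : S) ^ (K + 1) = (x + y) * n ^ K := by rw [hy]; ring
        _ = y * n ^ K + x * n ^ K := by ring
        _ = _ := by rw [hz]; ring
  -- `h` is the quotient of `n ^ (K + 1) - y ^ (K + 1)` by `n - y = x`; it exceeds any prescribed
  -- multiple of `y ^ K` when `K` is large.
  have hdiv : ∀ K : ℕ, ∃ h z : S, (n : S) ^ (K + 1) = y ^ (K + 1) + x * h ∧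
      h = n ^ K + K * y ^ K + z := by
    intro K
    induction K with
    | zero => exact ⟨1, 0, by simp [← hy, add_comm], by simp⟩
    | succ K ih =>
      obtain ⟨h, z, h1, h2⟩ := ih
      obtain ⟨w, hw⟩ := hpow K
      refine ⟨n ^ (K + 1) + y * h, y * w + y * z, ?_, ?_⟩
      · calc (n : S) ^ (K + 1 + 1) = (x + y) * n ^ (K + 1) := by rw [hy]; ring
          _ = x * n ^ (K + 1) + y * n ^ (K + 1) := by ring
          _ = x * n ^ (K + 1) + y * (y ^ (K + 1) + x * h) := by rw [← h1]
          _ = _ := by ring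
      · rw [h2, hw]; push_cast; ring
  -- With `K = m * n` the multiple `(b + 1) * h` absorbs `m * y ^ (K + 1) ≤ m * n * y ^ K`; the
  -- remaining summand `n ^ K` is kept because it makes `x` a summand of `x * Q` below.
  obtain ⟨h, z, h1, h2⟩ := hdiv (m * n)
  set K := m * n with hK
  obtain ⟨w, hw⟩ : ∃ w : S, ((b + 1 : ℕ) : S) * h = m * y ^ (K + 1) + (n ^ K + w) := by
    refine ⟨b * n ^ K + m * x * y ^ K + b * K * y ^ K + (b + 1) * z, ?_⟩
    have : (K : S) = m * (x + y) := by rw [hy, hK]; push_cast; rfl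
    calc ((b + 1 : ℕ) : S) * h = (b + 1) * (n ^ K + K * y ^ K + z) := by rw [h2]; push_cast; ring
      _ = (b + 1) * n ^ K + (b * K * y ^ K + K * y ^ K) + (b + 1) * z := by ring
      _ = (b + 1) * n ^ K + (b * K * y ^ K + m * (x + y) * y ^ K) + (b + 1) * z := by rw [← this]
      _ = _ := by ring
  set Q := q₀ * y ^ (K + 1) + (n ^ K + w) with hQ
  set N : ℕ := (b + 1) * n ^ (K + 1) with hN
  have hNpos : 0 < N := by positivity
  -- The equality `x * Q = N` holds stably.
  have hst : x * Q + x * m * y ^ (K + 1) = N + x * m * y ^ (K + 1) := by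
    calc x * Q + x * m * y ^ (K + 1)
        = (x * q₀) * y ^ (K + 1) + x * (m * y ^ (K + 1) + (n ^ K + w)) := by rw [hQ]; ring
      _ = (((b + 1 : ℕ) : S) + x * m) * y ^ (K + 1) + x * (((b + 1 : ℕ) : S) * h) := by
          rw [hq₀, hw]
      _ = ((b + 1 : ℕ) : S) * (y ^ (K + 1) + x * h) + x * m * y ^ (K + 1) := by ring
      _ = N + x * m * y ^ (K + 1) := by rw [← h1, hN]; push_cast; ring
  obtain ⟨C, s, hC⟩ := hc (x * m * y ^ (K + 1))
  set F := x * Q with hF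
  -- The summand to be cancelled is a positive integer ...
  have hs : F + ((s + 1 : ℕ) : S) = N + ((s + 1 : ℕ) : S) := by
    calc F + ((s + 1 : ℕ) : S) = (F + x * m * y ^ (K + 1)) + (C + 1) := by
          push_cast; rw [← hC]; ring
      _ = N + ((s + 1 : ℕ) : S) := by rw [hst]; push_cast; rw [← hC]; ring
  have hs' : 0 < s + 1 := s.succ_pos
  generalize s + 1 = s' at hs hs'
  -- ... which is a summand of a multiple of `F`.
  obtain ⟨l, v, hl⟩ : ∃ (l : ℕ) (v : S), F * l = s' + v := by
    obtain ⟨q', M, hM⟩ := hc q₀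
    have hx : x * M = 1 + (b + x * m + x * q') := by
      rw [← hM, mul_add, ← hq₀]; push_cast; ring
    obtain ⟨c, hc'⟩ : ∃ c : ℕ, n ^ K = c + 1 :=
      ⟨n ^ K - 1, (Nat.sub_add_cancel (Nat.pow_pos hn0)).symm⟩
    have hc'' : (n : S) ^ K = c + 1 := by rw [← Nat.cast_pow, hc']; push_cast; rfl
    refine ⟨M * s', (b + x * m + x * q' + x * (q₀ * y ^ (K + 1) + c + w) * M) * s', ?_⟩
    calc F * ((M * s' : ℕ) : S) = (x * M + x * (q₀ * y ^ (K + 1) + c + w) * M) * s' := by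
          rw [hF, hQ, hc'']; push_cast; ring
      _ = _ := by rw [hx]; ring
  have hone : F + F * l = N + F * l := by
    rw [hl, ← add_assoc, hs, add_assoc]
  have hmany : ∀ k : ℕ, F * k + F * l = N * k + F * l := by
    intro k
    induction k with
    | zero => simp
    | succ k ih =>
      calc F * ((k + 1 : ℕ) : S) + F * l = F + (F * k + F * l) := by push_cast; ring
        _ = N * k + (F + F * l) := by rw [ih]; ring
        _ = _ := by rw [hone]; push_cast; ring
  have hstab : ∀ k : ℕ, F * k + s' = N * k + s' := by
    intro k
    induction k with
    | zero => simp
    | succ k ih =>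
      calc F * ((k + 1 : ℕ) : S) + s' = F + (F * k + s') := by push_cast; ring
        _ = N * k + (F + s') := by rw [ih]; ring
        _ = _ := by rw [hs]; push_cast; ring
  refine ⟨Q * ((s' + l : ℕ) : S), N * (s' + l), Nat.mul_pos hNpos (by omega), ?_⟩
  obtain ⟨N', hN'⟩ : ∃ N', N = N' + 1 := ⟨N - 1, by omega⟩
  calc x * (Q * ((s' + l : ℕ) : S)) = F * s' + F * l := by push_cast; ring
    _ = (F * l + s') + N' * s' := by rw [hmany s', hN']; push_cast; ring
    _ = ((N * (s' + l) : ℕ) : S) := by rw [hstab l, hN']; push_cast; ring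

end Semiring

/-! ### The semiring of classes of finitely generated projective modules -/

section ProjectiveClasses

variable (R : Type u) [CommRing R]

/-- Finitely generated projective modules over `R`. Up to isomorphism all of them lie in the
universe of `R`. -/
structure FGProj : Type (u + 1) where
  carrier : Type u
  [addCommGroup : AddCommGroup carrier]
  [module : Module R carrier]
  [finite : Module.Finite R carrier]
  [projective : Module.Projective R carrier]

attribute [instance] FGProj.addCommGroup FGProj.module FGProj.finite FGProj.projective

/-- Isomorphism of modules. -/
instance fgProjSetoid : Setoid (FGProj R) where
  r M N := Nonempty (M.carrier ≃ₗ[R] N.carrier)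
  iseqv :=
    { refl := fun _ => ⟨LinearEquiv.refl R _⟩
      symm := fun ⟨e⟩ => ⟨e.symm⟩
      trans := fun ⟨e⟩ ⟨f⟩ => ⟨e.trans f⟩ }

/-- The isomorphism classes of finitely generated projective `R`-modules, a semiring under `⊕`
and `⊗`. -/
def ProjClass : Type (u + 1) := Quotient (fgProjSetoid R)

variable {R}

/-- The isomorphism class of a finitely generated projective module. -/
def ProjClass.mk (M : Type u) [AddCommGroup M] [Module R M] [Module.Finite R M]
    [Module.Projective R M] : ProjClass R :=
  Quotient.mk (fgProjSetoid R) ⟨M⟩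

theorem ProjClass.mk_eq_mk {M N : Type u} [AddCommGroup M] [Module R M] [Module.Finite R M]
    [Module.Projective R M] [AddCommGroup N] [Module R N] [Module.Finite R N]
    [Module.Projective R N] :
    (ProjClass.mk M : ProjClass R) = ProjClass.mk N ↔ Nonempty (M ≃ₗ[R] N) := Quotient.eq

theorem ProjClass.mk_eq_mk_of_equiv {M N : Type u} [AddCommGroup M] [Module R M] [Module.Finite R M]
    [Module.Projective R M] [AddCommGroup N] [Module R N] [Module.Finite R N]
    [Module.Projective R N] (e : M ≃ₗ[R] N) : (ProjClass.mk M : ProjClass R) = ProjClass.mk N :=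
  ProjClass.mk_eq_mk.2 ⟨e⟩

instance : Add (ProjClass R) where
  add := Quotient.map₂ (fun M N => ⟨M.carrier × N.carrier⟩)
    (fun _ _ ⟨e⟩ _ _ ⟨f⟩ => ⟨e.prodCongr f⟩)

instance : Zero (ProjClass R) where
  zero := ProjClass.mk PUnit

instance ProjClass.commSemiring : CommSemiring (ProjClass R) where
  nsmul := nsmulRec
  mul := Quotient.map₂ (fun M N => ⟨M.carrier ⊗[R] N.carrier⟩)
    (fun _ _ ⟨e⟩ _ _ ⟨f⟩ => ⟨TensorProduct.congr e f⟩)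
  one := ProjClass.mk R
  add_assoc := by
    rintro ⟨A⟩ ⟨B⟩ ⟨C⟩
    exact Quotient.sound ⟨LinearEquiv.prodAssoc R A.carrier B.carrier C.carrier⟩
  zero_add := by
    rintro ⟨A⟩
    exact Quotient.sound ⟨LinearEquiv.uniqueProd⟩
  add_zero := by
    rintro ⟨A⟩
    exact Quotient.sound ⟨LinearEquiv.prodUnique⟩
  add_comm := by
    rintro ⟨A⟩ ⟨B⟩
    exact Quotient.sound ⟨LinearEquiv.prodComm R A.carrier B.carrier⟩
  mul_assoc := by
    rintro ⟨A⟩ ⟨B⟩ ⟨C⟩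
    exact Quotient.sound ⟨TensorProduct.assoc R A.carrier B.carrier C.carrier⟩
  one_mul := by
    rintro ⟨A⟩
    exact Quotient.sound ⟨TensorProduct.lid R A.carrier⟩
  mul_one := by
    rintro ⟨A⟩
    exact Quotient.sound ⟨TensorProduct.rid R A.carrier⟩
  mul_comm := by
    rintro ⟨A⟩ ⟨B⟩
    exact Quotient.sound ⟨TensorProduct.comm R A.carrier B.carrier⟩
  left_distrib := by
    rintro ⟨A⟩ ⟨B⟩ ⟨C⟩
    exact Quotient.sound ⟨TensorProduct.prodRight R R A.carrier B.carrier C.carrier⟩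
  right_distrib := by
    rintro ⟨A⟩ ⟨B⟩ ⟨C⟩
    exact Quotient.sound ⟨TensorProduct.prodLeft R R A.carrier B.carrier C.carrier⟩
  zero_mul := by
    rintro ⟨A⟩
    exact Quotient.sound
      ⟨LinearEquiv.ofSubsingleton (PUnit.{u + 1} ⊗[R] A.carrier) PUnit.{u + 1}⟩
  mul_zero := by
    rintro ⟨A⟩
    exact Quotient.sound
      ⟨LinearEquiv.ofSubsingleton (A.carrier ⊗[R] PUnit.{u + 1}) PUnit.{u + 1}⟩

namespace ProjClass

theorem mk_fin (n : ℕ) : (mk (Fin n → R) : ProjClass R) = n := by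
  induction n with
  | zero =>
    rw [Nat.cast_zero]
    exact mk_eq_mk_of_equiv (LinearEquiv.ofSubsingleton (Fin 0 → R) PUnit.{u + 1})
  | succ n ih =>
    rw [Nat.cast_succ, ← ih, add_comm (mk _) 1]
    exact mk_eq_mk_of_equiv (Fin.consLinearEquiv R (fun _ : Fin (n + 1) => R)).symm

/-- Every finitely generated projective module is a direct summand of a free module of finite rank. -/
theorem exists_add_eq_natCast (y : ProjClass R) : ∃ (y' : ProjClass R) (n : ℕ), y + y' = n := by
  obtain ⟨P⟩ := y
  obtain ⟨n, f, g, -, hg, hfg⟩ := Module.Finite.exists_comp_eq_id_of_projective R P.carrier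
  have hfg' : ∀ p, f (g p) = p := LinearMap.congr_fun hfg
  let e : (P.carrier × LinearMap.ker f) ≃ₗ[R] (Fin n → R) :=
    { toFun := fun p => g p.1 + p.2
      map_add' := fun p q => by
        simp only [Prod.fst_add, Prod.snd_add, map_add, Submodule.coe_add]
        abel
      map_smul' := fun r p => by simp
      invFun := fun v => (f v, ⟨v - g (f v), by simp [hfg']⟩)
      left_inv := fun ⟨p, q, hq⟩ => by
        have hq : f q = 0 := hq
        ext <;> simp [hfg', hq]
      right_inv := fun v => by simp }
  have h1 : Module.Finite R (P.carrier × LinearMap.ker f) := Module.Finite.equiv e.symm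
  have h2 : Module.Projective R (P.carrier × LinearMap.ker f) := Module.Projective.of_equiv e.symm
  have h3 : Module.Finite R (LinearMap.ker f) :=
    Module.Finite.of_surjective (LinearMap.snd R P.carrier (LinearMap.ker f))
      LinearMap.snd_surjective
  have h4 : Module.Projective R (LinearMap.ker f) :=
    Module.Projective.of_split (LinearMap.inr R P.carrier (LinearMap.ker f))
      (LinearMap.snd R P.carrier (LinearMap.ker f)) (LinearMap.snd_comp_inr R _ _)
  exact ⟨mk (LinearMap.ker f), n, (mk_eq_mk_of_equiv e).trans (mk_fin n)⟩

end ProjClass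

end ProjectiveClasses

/-! ### Factorizations of scalars through finitely generated projective modules -/

section Factorization

variable {R : Type u} [CommRing R]

/-- Multiplication by `f` factors in both orders through linear maps between modules of the classes
`x` and `y`. Equivalently, the `ℤ/2`-graded module with these two components has an odd endomorphism
with square `f`. -/
def IsFactored (f : R) (x y : ProjClass R) : Prop :=
  ∃ (M N : FGProj R) (α : M.carrier →ₗ[R] N.carrier) (β : N.carrier →ₗ[R] M.carrier),
    x = ProjClass.mk M.carrier ∧ y = ProjClass.mk N.carrier ∧
      (∀ m, β (α m) = f • m) ∧ ∀ n, α (β n) = f • n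

theorem IsFactored.eq_of_one {x y : ProjClass R} (h : IsFactored 1 x y) : x = y := by
  obtain ⟨M, N, α, β, rfl, rfl, h1, h2⟩ := h
  exact ProjClass.mk_eq_mk_of_equiv (LinearEquiv.ofLinearMap α β
    (LinearMap.ext fun n => by simpa using h2 n) (LinearMap.ext fun m => by simpa using h1 m))

theorem IsFactored.smul {f : R} {x y : ProjClass R} (c : R) (h : IsFactored f x y) :
    IsFactored (c * f) x y := by
  obtain ⟨M, N, α, β, hx, hy, h1, h2⟩ := h
  exact ⟨M, N, c • α, β, hx, hy, fun m => by simp [h1, mul_smul], fun n => by simp [h2, mul_smul]⟩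

theorem isFactored_zero (x y : ProjClass R) : IsFactored 0 x y := by
  obtain ⟨M⟩ := x
  obtain ⟨N⟩ := y
  exact ⟨M, N, 0, 0, rfl, rfl, by simp, by simp⟩

/-- The graded tensor product of odd endomorphisms with squares `f` and `g` carries an odd
endomorphism with square `f + g`; the sign rule makes the mixed terms cancel. -/
theorem IsFactored.tensor {f g : R} {x y z w : ProjClass R} (h : IsFactored f x y)
    (k : IsFactored g z w) : IsFactored (f + g) (x * z + y * w) (y * z + x * w) := by
  obtain ⟨M, N, α, β, rfl, rfl, h1, h2⟩ := h
  obtain ⟨M', N', α', β', rfl, rfl, k1, k2⟩ := k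
  have hr : ∀ {A B : Type u} (C : Type u) [AddCommGroup A] [Module R A] [AddCommGroup B]
      [Module R B] [AddCommGroup C] [Module R C] (a : A →ₗ[R] B) (b : B →ₗ[R] A) (r : R),
      (∀ m, b (a m) = r • m) → ∀ t : A ⊗[R] C, b.rTensor C (a.rTensor C t) = r • t := by
    intro A B C _ _ _ _ _ _ a b r hab t
    have : b ∘ₗ a = r • LinearMap.id := LinearMap.ext hab
    rw [← LinearMap.rTensor_comp_apply, this, LinearMap.rTensor_smul, LinearMap.rTensor_id]
    rfl
  have hl : ∀ {A B : Type u} (C : Type u) [AddCommGroup A] [Module R A] [AddCommGroup B]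
      [Module R B] [AddCommGroup C] [Module R C] (a : A →ₗ[R] B) (b : B →ₗ[R] A) (r : R),
      (∀ m, b (a m) = r • m) → ∀ t : C ⊗[R] A, b.lTensor C (a.lTensor C t) = r • t := by
    intro A B C _ _ _ _ _ _ a b r hab t
    have : b ∘ₗ a = r • LinearMap.id := LinearMap.ext hab
    rw [← LinearMap.lTensor_comp_apply, this, LinearMap.lTensor_smul, LinearMap.lTensor_id]
    rfl
  have hc : ∀ {A B C D : Type u} [AddCommGroup A] [Module R A] [AddCommGroup B]
      [Module R B] [AddCommGroup C] [Module R C] [AddCommGroup D] [Module R D]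
      (a : A →ₗ[R] B) (b : C →ₗ[R] D) (t : A ⊗[R] C),
      b.lTensor B (a.rTensor C t) = a.rTensor D (b.lTensor A t) := by
    intro A B C D _ _ _ _ _ _ _ _ a b t
    rw [← LinearMap.comp_apply, ← LinearMap.comp_apply, LinearMap.lTensor_comp_rTensor,
      LinearMap.rTensor_comp_lTensor]
  refine ⟨⟨(M.carrier ⊗[R] M'.carrier) × (N.carrier ⊗[R] N'.carrier)⟩,
    ⟨(N.carrier ⊗[R] M'.carrier) × (M.carrier ⊗[R] N'.carrier)⟩,
    LinearMap.prod ((α.rTensor _).coprod (β'.lTensor _)) ((α'.lTensor _).coprod (-β.rTensor _)),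
    LinearMap.prod ((β.rTensor _).coprod (β'.lTensor _)) ((α'.lTensor _).coprod (-α.rTensor _)),
    rfl, rfl, ?_, ?_⟩
  · rintro ⟨p, q⟩
    ext
    · simp [hr _ _ _ _ h1, hl _ _ _ _ k1, hc, add_smul]
      abel
    · simp [hr _ _ _ _ h2, hl _ _ _ _ k2, hc, add_smul]
      abel
  · rintro ⟨p, q⟩
    ext
    · simp [hr _ _ _ _ h2, hl _ _ _ _ k1, hc, add_smul]
      abel
    · simp [hr _ _ _ _ h1, hl _ _ _ _ k2, hc, add_smul]
      abel

variable (P : Type u) [AddCommGroup P] [Module R P] [Module.Finite R P] [Module.Projective R P]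
  [FaithfulSMul R P]

/-- `P` is free of positive rank at `m`; the localized isomorphism and its inverse become maps over
`R` after clearing denominators. -/
theorem exists_isFactored_notMem (m : Ideal R) [m.IsMaximal] :
    ∃ f ∉ m, ∃ r : ℕ, 0 < r ∧ IsFactored f (r : ProjClass R) (ProjClass.mk P) := by
  have : Module.FinitePresentation R P := Module.finitePresentation_of_projective R P
  let S := m.primeCompl
  let Rm := Localization.AtPrime m
  let Pm := LocalizedModule S P
  have : Module.Projective Rm Pm :=
    Module.projective_of_isLocalizedModule S (LocalizedModule.mkLinearMap S P)
  have : Module.Free Rm Pm := Module.free_of_flat_of_isLocalRing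
  let r := Module.finrank Rm Pm
  let e : Pm ≃ₗ[R] (Fin r → Rm) := (Module.finBasis Rm Pm).equivFun.restrictScalars R
  let i : P →ₗ[R] Pm := LocalizedModule.mkLinearMap S P
  let j : (Fin r → R) →ₗ[R] (Fin r → Rm) :=
    LinearMap.pi fun k => Algebra.linearMap R Rm ∘ₗ LinearMap.proj k
  have : IsLocalizedModule S j := inferInstance
  obtain ⟨β, u, hβ⟩ := Module.FinitePresentation.exists_lift_of_isLocalizedModule S j
    (e.toLinearMap ∘ₗ i)
  obtain ⟨α, v, hα⟩ := Module.FinitePresentation.exists_lift_of_isLocalizedModule S i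
    (e.symm.toLinearMap ∘ₗ j)
  have hα' : ∀ x, i (α x) = (v : R) • e.symm (j x) := fun x => LinearMap.congr_fun hα x
  have hβ' : ∀ x, j (β x) = (u : R) • e (i x) := fun x => LinearMap.congr_fun hβ x
  have h1 : i ∘ₗ (α ∘ₗ β) = i ∘ₗ (((u * v : S) : R) • LinearMap.id) := by
    ext x
    simp [hα', hβ', mul_smul, smul_comm (u : R) (v : R)]
  have h2 : j ∘ₗ (β ∘ₗ α) = j ∘ₗ (((u * v : S) : R) • LinearMap.id) := by
    refine LinearMap.ext fun x => ?_
    simp only [LinearMap.comp_apply, hβ', hα', map_smul, LinearEquiv.apply_symm_apply,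
      LinearMap.smul_apply, LinearMap.id_apply, smul_smul, Submonoid.coe_mul]
  obtain ⟨s, hs⟩ := Module.Finite.exists_smul_of_comp_eq_of_isLocalizedModule S i _ _ h1
  obtain ⟨t, ht⟩ := Module.Finite.exists_smul_of_comp_eq_of_isLocalizedModule S j _ _ h2
  have hs' : ∀ x, (s : R) • α (β x) = (s : R) • (u * v : R) • x := fun x => LinearMap.congr_fun hs x
  have ht' : ∀ x, (t : R) • β (α x) = (t : R) • (u * v : R) • x := fun x => LinearMap.congr_fun ht x
  have hf : ((s * t * (u * v) : S) : R) ∉ m := (s * t * (u * v) : S).2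
  have hP : ∀ x, α ((s * t : R) • β x) = ((s * t * (u * v) : S) : R) • x := fun x => by
    rw [map_smul, mul_comm, mul_smul, hs']
    simp only [smul_smul, Submonoid.coe_mul]
    congr 1
    ring
  have hR : ∀ x, (s * t : R) • β (α x) = ((s * t * (u * v) : S) : R) • x := fun x => by
    rw [mul_smul, ht']
    simp only [smul_smul, Submonoid.coe_mul]
    congr 1
    ring
  refine ⟨_, hf, r, Nat.pos_of_ne_zero fun hr => hf ?_, ⟨Fin r → R⟩, ⟨P⟩, α, (s * t : R) • β,
    (ProjClass.mk_fin r).symm, rfl, hR, hP⟩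
  -- If the rank at `m` were zero, then a scalar outside `m` would annihilate `P`.
  have : IsEmpty (Fin r) := by rw [hr]; infer_instance
  have h0 : ((s * t * (u * v) : S) : R) = 0 := by
    refine FaithfulSMul.eq_of_smul_eq_smul (α := P) fun x => ?_
    rw [← hP, zero_smul, Subsingleton.elim ((s * t : R) • β x) 0, map_zero]
  rw [h0]
  exact m.zero_mem

/-- The elements `f` through which some classes `a + [P] * e` and `[P] * o` with `a > 0` are
factored form an ideal that lies in no maximal ideal, so `f = 1` is one of them. For constant rank `r`
the conclusion reflects the nilpotence of `[P] - r` in `K₀(R)`. -/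
theorem exists_natCast_add_eq_mul : ∃ (a : ℕ) (e o : ProjClass R), 0 < a ∧
    (a : ProjClass R) + ProjClass.mk P * e = ProjClass.mk P * o := by
  let x : ProjClass R := ProjClass.mk P
  let I : Ideal R :=
    { carrier := {f | ∃ (a : ℕ) (e o : ProjClass R), 0 < a ∧ IsFactored f (a + x * e) (x * o)}
      zero_mem' := ⟨1, 0, 0, one_pos, isFactored_zero _ _⟩
      add_mem' := by
        rintro f g ⟨a, e, o, ha, h⟩ ⟨b, e', o', hb, k⟩
        refine ⟨a * b, a * e' + e * b + x * e * e' + x * o * o',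
          o * (b + x * e') + (a + x * e) * o', Nat.mul_pos ha hb, ?_⟩
        convert h.tensor k using 1
        · push_cast; ring
        · ring
      smul_mem' := by
        rintro c f ⟨a, e, o, ha, h⟩
        exact ⟨a, e, o, ha, h.smul c⟩ }
  have hI : I = ⊤ := by
    by_contra hne
    obtain ⟨m, hm, hle⟩ := I.exists_le_maximal hne
    obtain ⟨f, hf, r, hr, h⟩ := exists_isFactored_notMem P m
    exact hf (hle ⟨r, 0, 1, hr, by simpa using h⟩)
  obtain ⟨a, e, o, ha, h⟩ := (Ideal.eq_top_iff_one I).1 hI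
  exact ⟨a, e, o, ha, h.eq_of_one⟩

/-- **Bass's theorem**: a faithful finitely generated projective module becomes free of positive
rank after tensoring with a suitable finitely generated projective module. -/
theorem exists_tensor_equiv_free : ∃ (Q : FGProj R) (N : ℕ), 0 < N ∧
    Nonempty ((P ⊗[R] Q.carrier) ≃ₗ[R] (Fin N → R)) := by
  obtain ⟨a, e, o, ha, h⟩ := exists_natCast_add_eq_mul (R := R) P
  obtain ⟨⟨Q⟩, N, hN, hq⟩ := exists_mul_eq_natCast ProjClass.exists_add_eq_natCast ha h
  exact ⟨Q, N, hN, ProjClass.mk_eq_mk.1 (hq.trans (ProjClass.mk_fin N).symm)⟩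

end Factorization

/-! ### Azumaya algebras are tensor factors of matrix algebras -/

section AzumayaInverse

variable {R : Type*} [CommRing R]

theorem exists_dual_basis (Q : Type*) [AddCommGroup Q] [Module R Q] [Module.Finite R Q]
    [Module.Projective R Q] : ∃ (n : ℕ) (b : Fin n → Q) (g : Q →ₗ[R] Fin n → R),
      ∀ q, ∑ i, g q i • b i = q := by
  obtain ⟨n, f, g, -, -, hfg⟩ := Module.Finite.exists_comp_eq_id_of_projective R Q
  refine ⟨n, fun i => f (Pi.single i 1), g, fun q => ?_⟩
  refine Eq.trans ?_ (LinearMap.congr_fun hfg q)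
  rw [LinearMap.comp_apply]
  conv_rhs => rw [pi_eq_sum_univ' (g q), map_sum]
  simp only [map_smul]

/-- A dual basis of `Q` provides analogues of the matrix units, and with them the inverse of
`End Q ⊗ (End Q)ᵐᵒᵖ → End (End Q)` is given by the formula for a matrix algebra. -/
theorem isAzumaya_end (Q : Type*) [AddCommGroup Q] [Module R Q] [Module.Finite R Q]
    [Module.Projective R Q] [FaithfulSMul R Q] : IsAzumaya R (Module.End R Q) := by
  obtain ⟨n, b, g, hQ⟩ := exists_dual_basis (R := R) Q
  -- `E i q` is the endomorphism `q' ↦ g q' i • q`.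
  let E : Fin n → Q →ₗ[R] Module.End R Q := fun i =>
    LinearMap.smulRightₗ ((LinearMap.proj i).comp g)
  have hE : ∀ i q q', E i q q' = g q' i • q := fun i q q' => by simp [E]
  have hu : ∀ u : Module.End R Q, ∑ i, E i (u (b i)) = u := by
    intro u
    ext q
    simp only [LinearMap.sum_apply, hE]
    conv_rhs => rw [← hQ q, map_sum]
    simp
  have hu' : ∀ u : Module.End R Q, ∑ i, ∑ k, g (u (b k)) i • E k (b i) = u := by
    intro u
    rw [Finset.sum_comm]
    conv_rhs => rw [← hu u]
    refine Finset.sum_congr rfl fun k _ => ?_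
    conv_rhs => rw [← hQ (u (b k)), map_sum]
    simp
  let inv : Module.End R (Module.End R Q) → Module.End R Q ⊗[R] (Module.End R Q)ᵐᵒᵖ := fun φ =>
    ∑ j, ∑ k, ∑ l, E j (φ (E k (b j)) (b l)) ⊗ₜ[R] MulOpposite.op (E l (b k))
  have hfin : Module.Finite R (Module.End R Q) :=
    Module.Finite.equiv (dualTensorHomEquiv R Q Q)
  have hproj : Module.Projective R (Module.End R Q) :=
    Module.Projective.of_equiv (dualTensorHomEquiv R Q Q)
  exact
    { eq_of_smul_eq_smul := fun {r s} h => FaithfulSMul.eq_of_smul_eq_smul (α := Q) fun q => by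
        simpa using LinearMap.congr_fun (h LinearMap.id) q
      bij := by
        refine Function.bijective_iff_has_inverse.2 ⟨inv, fun t => ?_, fun φ => ?_⟩
        · induction t with
          | zero => simp [inv]
          | add x y hx hy =>
            conv_rhs => rw [← hx, ← hy]
            simp [inv, Finset.sum_add_distrib, TensorProduct.add_tmul]
          | tmul u v =>
            induction v using MulOpposite.rec' with
            | _ v =>
            simp only [inv, AlgHom.mulLeftRight_apply, MulOpposite.unop_op, Module.End.mul_apply,
              hE, map_smul]
            conv_rhs => rw [← hu u, TensorProduct.sum_tmul]
            refine Finset.sum_congr rfl fun j _ => ?_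
            conv_rhs => rw [← hu' v]
            simp only [Finset.op_sum, MulOpposite.op_smul, TensorProduct.tmul_sum,
              TensorProduct.tmul_smul, TensorProduct.smul_tmul']
        · ext y : 1
          simp only [inv, map_sum, LinearMap.sum_apply, AlgHom.mulLeftRight_apply,
            MulOpposite.unop_op]
          have h1 : ∀ j k l, E j (φ (E k (b j)) (b l)) * y * E l (b k) =
              g (y (b k)) j • E l (φ (E k (b j)) (b l)) := by
            intro j k l
            ext q
            simp [hE, smul_smul, mul_comm]
          simp only [h1, ← Finset.smul_sum, hu]
          conv_rhs => rw [← hu' y]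
          simp }

theorem isAzumaya_op (A : Type*) [Ring A] [Algebra R A] [hA : IsAzumaya R A] :
    IsAzumaya R Aᵐᵒᵖ where
  toProjective := Module.Projective.of_equiv (MulOpposite.opLinearEquiv R)
  eq_of_smul_eq_smul {r s} h := FaithfulSMul.eq_of_smul_eq_smul (α := A) fun a =>
    MulOpposite.op_injective (h (MulOpposite.op a))
  bij := by
    let e : Aᵐᵒᵖ ⊗[R] Aᵐᵒᵖᵐᵒᵖ ≃ₗ[R] A ⊗[R] Aᵐᵒᵖ :=
      (TensorProduct.congr (LinearEquiv.refl R _) (AlgEquiv.opOp R A).symm.toLinearEquiv).trans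
        (TensorProduct.comm R Aᵐᵒᵖ A)
    let c := (MulOpposite.opLinearEquiv R : A ≃ₗ[R] Aᵐᵒᵖ).conj
    have h := c.bijective.comp (hA.bij.comp e.bijective)
    convert h using 1
    have : (AlgHom.mulLeftRight R Aᵐᵒᵖ).toLinearMap =
        c.toLinearMap ∘ₗ (AlgHom.mulLeftRight R A).toLinearMap ∘ₗ e.toLinearMap := by
      refine TensorProduct.ext' fun x y => ?_
      ext z
      simp [c, e, LinearEquiv.conj_apply, mul_assoc]
    exact congrArg DFunLike.coe this

/-- `End P ⊗ End Q ≅ End (P ⊗ Q)` for finitely generated projective modules. -/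
def endTensorEndEquiv (P Q : Type*) [AddCommGroup P] [Module R P] [Module.Finite R P]
    [Module.Projective R P] [AddCommGroup Q] [Module R Q] [Module.Finite R Q]
    [Module.Projective R Q] :
    Module.End R P ⊗[R] Module.End R Q ≃ₐ[R] Module.End R (P ⊗[R] Q) :=
  AlgEquiv.ofBijective (Module.endTensorEndAlgHom (R := R) (S := R) (A := R) (M := P) (N := Q))
    (by
      have h : (Module.endTensorEndAlgHom (R := R) (S := R) (A := R) (M := P) (N := Q)).toLinearMap
          = TensorProduct.homTensorHomMap (RingHom.id R) P Q P Q :=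
        TensorProduct.ext' fun u v => TensorProduct.ext' fun p q => by
          simp [Module.endTensorEndAlgHom_apply]
      have := homTensorHomMap_bijective (R := R) (A := P) (B := Q)
      rw [← h] at this
      exact this)

end AzumayaInverse

/-- If `A ⊗ Q` is free, then `A ⊗ (Aᵐᵒᵖ ⊗ End Q) ≅ End A ⊗ End Q ≅ End (A ⊗ Q)` is a matrix
algebra. -/
theorem AzumayaAlg.exists_tensor_equiv_matrix {R : Type u} [CommRing R] (A : AzumayaAlg R) :
    ∃ (B : AzumayaAlg R) (N : ℕ), 0 < N ∧
      Nonempty ((A.carrier ⊗[R] B.carrier) ≃ₐ[R] Matrix (Fin N) (Fin N) R) := by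
  obtain ⟨Q, N, hN, ⟨e⟩⟩ := exists_tensor_equiv_free (R := R) A.carrier
  have : FaithfulSMul R Q.carrier := ⟨fun {r s} h => by
    have h1 : ∀ t : A.carrier ⊗[R] Q.carrier, r • t = s • t := fun t => by
      induction t with
      | zero => simp
      | add x y hx hy => rw [smul_add, smul_add, hx, hy]
      | tmul a q => rw [← TensorProduct.tmul_smul, h q, TensorProduct.tmul_smul]
    have h2 := congrArg e (h1 (e.symm fun _ => 1))
    rw [map_smul, map_smul, e.apply_symm_apply] at h2
    simpa using congrFun h2 ⟨0, hN⟩⟩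
  have h1 : IsAzumaya R A.carrierᵐᵒᵖ := isAzumaya_op A.carrier
  have h2 : IsAzumaya R (Module.End R Q.carrier) := isAzumaya_end Q.carrier
  have h3 : IsAzumaya R (A.carrierᵐᵒᵖ ⊗[R] Module.End R Q.carrier) := isAzumaya_tensor
  refine ⟨⟨A.carrierᵐᵒᵖ ⊗[R] Module.End R Q.carrier⟩, N, hN, ⟨?_⟩⟩
  exact (Algebra.TensorProduct.assoc R R R A.carrier A.carrierᵐᵒᵖ
      (Module.End R Q.carrier)).symm.trans <|
    (Algebra.TensorProduct.congr (AlgEquiv.ofBijective (AlgHom.mulLeftRight R A.carrier)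
      IsAzumaya.bij) AlgEquiv.refl).trans <|
    (endTensorEndEquiv A.carrier Q.carrier).trans <|
    (e.conjAlgEquiv R).trans LinearMap.toMatrixAlgEquiv'

/-! ### Derivations of matrix algebras and of Azumaya algebras -/

section Derivations

variable {R : Type*} [CommRing R]

/-- The coordinates of `1` generate the unit ideal, by Nakayama's lemma. -/
theorem exists_linearMap_one_eq_one (B : Type*) [Ring B] [Algebra R B] [Module.Finite R B]
    [Module.Projective R B] [FaithfulSMul R B] : ∃ l : B →ₗ[R] R, l 1 = 1 := by
  obtain ⟨n, b, g, hB⟩ := exists_dual_basis (R := R) B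
  let I : Ideal R := LinearMap.range (LinearMap.applyₗ (1 : B) : (B →ₗ[R] R) →ₗ[R] R)
  have hmem : ∀ x : B, x ∈ I • (⊤ : Submodule R B) := by
    intro x
    rw [← one_mul x, ← hB 1, Finset.sum_mul]
    refine Submodule.sum_mem _ fun i _ => ?_
    rw [smul_mul_assoc]
    exact Submodule.smul_mem_smul ⟨(LinearMap.proj i).comp g, rfl⟩ Submodule.mem_top
  obtain ⟨r, hr, hr0⟩ := Submodule.exists_sub_one_mem_and_smul_eq_zero_of_fg_of_le_smul I ⊤
    (Module.Finite.fg_top (R := R) (M := B)) fun b _ => hmem b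
  have : r = 0 := FaithfulSMul.eq_of_smul_eq_smul (α := B) fun b => by
    rw [hr0 b Submodule.mem_top, zero_smul]
  rw [this, zero_sub, neg_mem_iff] at hr
  exact hr

variable [Differential R] {A B : Type*} [Ring A] [Algebra R A] [Ring B] [Algebra R B]

/-- Transport of a derivation along an isomorphism. -/
theorem IsDiffAlg.conj {D : A →+ A} (hD : IsDiffAlg R D) (e : A ≃ₐ[R] B) :
    IsDiffAlg R ((e : A →+ B).comp (D.comp (e.symm : B →+ A))) where
  leibniz a b := by simp [hD.leibniz]
  map_algebraMap r := by simp [hD.map_algebraMap]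

/-- For a linear retraction `l` of `R → B`, the map `a ↦ (1 ⊗ l) (D (a ⊗ 1))` is a derivation,
because `1 ⊗ l` is a homomorphism of `A`-bimodules. -/
theorem IsDiffAlg.exists_of_tensor {D : A ⊗[R] B →+ A ⊗[R] B} (hD : IsDiffAlg R D)
    {l : B →ₗ[R] R} (hl : l 1 = 1) : ∃ E : A →+ A, IsDiffAlg R E := by
  let p : A ⊗[R] B →ₗ[R] A := (TensorProduct.rid R A).toLinearMap ∘ₗ l.lTensor A
  have hp : ∀ a b, p (a ⊗ₜ b) = l b • a := fun a b => by simp [p]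
  have hleft : ∀ (a : A) (t : A ⊗[R] B), p (a ⊗ₜ 1 * t) = a * p t := by
    intro a t
    induction t with
    | zero => simp
    | add x y hx hy => simp only [mul_add, map_add, hx, hy]
    | tmul c d => simp [hp]
  have hright : ∀ (a : A) (t : A ⊗[R] B), p (t * a ⊗ₜ 1) = p t * a := by
    intro a t
    induction t with
    | zero => simp
    | add x y hx hy => simp only [add_mul, map_add, hx, hy]
    | tmul c d => simp [hp]
  let E : A →+ A := AddMonoidHom.mk' (fun a => p (D (a ⊗ₜ 1))) fun a b => by
    rw [TensorProduct.add_tmul, map_add, map_add]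
  refine ⟨E, ⟨fun a b => ?_, fun r => ?_⟩⟩
  · change p (D ((a * b) ⊗ₜ 1)) = p (D (a ⊗ₜ 1)) * b + a * p (D (b ⊗ₜ 1))
    have : ((a * b) ⊗ₜ[R] (1 : B)) = (a ⊗ₜ 1) * (b ⊗ₜ 1) := by simp
    rw [this, hD.leibniz, map_add, hleft, hright]
  · change p (D (algebraMap R A r ⊗ₜ 1)) = _
    rw [← Algebra.TensorProduct.algebraMap_apply, hD.map_algebraMap,
      Algebra.TensorProduct.algebraMap_apply, hp, hl, one_smul]

/-- The difference between `D` and the entrywise derivation is linear over `R`, and a linear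
derivation `δ` of a matrix algebra is the commutator with `∑ i, δ(e_{i0}) e_{0i}`. -/
theorem IsDiffAlg.exists_eq_matrixDeriv {n : Type*} [Fintype n] [DecidableEq n]
    {D : Matrix n n R →+ Matrix n n R} (hD : IsDiffAlg R D) :
    ∃ Z : Matrix n n R, D = matrixDeriv Z := by
  rcases isEmpty_or_nonempty n with hn | ⟨⟨o⟩⟩
  · exact ⟨0, Subsingleton.elim _ _⟩
  have h0 := isDiffAlg_matrix (0 : Matrix n n R)
  let δ : Matrix n n R →ₗ[R] Matrix n n R :=
    { toFun := fun Y => D Y - matrixDeriv 0 Y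
      map_add' := fun X Y => by simp only [map_add]; abel
      map_smul' := fun r Y => by
        rw [hD.map_smul, h0.map_smul, RingHom.id_apply, smul_sub]; abel }
  have hδ : ∀ X Y, δ (X * Y) = δ X * Y + X * δ Y := fun X Y => by
    change D (X * Y) - matrixDeriv 0 (X * Y) =
      (D X - matrixDeriv 0 X) * Y + X * (D Y - matrixDeriv 0 Y)
    rw [hD.leibniz, h0.leibniz]
    noncomm_ring
  let Z : Matrix n n R := ∑ i, δ (Matrix.single i o 1) * Matrix.single o i 1
  have hZ : δ = LinearMap.mulLeft R Z - LinearMap.mulRight R Z := by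
    refine (Matrix.stdBasis R n n).ext fun ⟨k, l⟩ => ?_
    rw [Matrix.stdBasis_eq_single, LinearMap.sub_apply, LinearMap.mulLeft_apply,
      LinearMap.mulRight_apply]
    have h1 : Z * Matrix.single k l 1 = δ (Matrix.single k o 1) * Matrix.single o l 1 := by
      rw [Finset.sum_mul, Finset.sum_eq_single k]
      · rw [mul_assoc, Matrix.single_mul_single_same, mul_one]
      · intro i _ hi
        rw [mul_assoc, Matrix.single_mul_single_of_ne _ _ _ _ hi, mul_zero]
      · simp
    have h2 : Matrix.single k l 1 * Z =
        δ (Matrix.single k o 1) * Matrix.single o l 1 - δ (Matrix.single k l 1) := by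
      have h3 : ∀ i, Matrix.single k l (1 : R) * (δ (Matrix.single i o 1) * Matrix.single o i 1) =
          δ (Matrix.single k l 1 * Matrix.single i o 1) * Matrix.single o i 1 -
            δ (Matrix.single k l 1) * Matrix.single i i 1 := by
        intro i
        rw [hδ, add_mul, mul_assoc (δ _), Matrix.single_mul_single_same, mul_one, add_sub_cancel_left,
          mul_assoc]
      rw [Finset.mul_sum, Finset.sum_congr rfl fun i _ => h3 i, Finset.sum_sub_distrib,
        ← Finset.mul_sum, Matrix.sum_single_one, mul_one, Finset.sum_eq_single l]
      · rw [Matrix.single_mul_single_same, mul_one]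
      · intro i _ hi
        rw [Matrix.single_mul_single_of_ne _ _ _ _ hi.symm, map_zero, zero_mul]
      · simp
    rw [h1, h2, sub_sub_cancel]
  refine ⟨Z, AddMonoidHom.ext fun Y => ?_⟩
  have h := LinearMap.congr_fun hZ Y
  change D Y - matrixDeriv 0 Y = Z * Y - Y * Z at h
  rw [eq_add_of_sub_eq h, matrixDeriv_apply, matrixDeriv_apply]
  noncomm_ring

end Derivations

section Classes

variable {R : Type u} [CommRing R] [Differential R]

/-- As `A` is a tensor factor of a matrix algebra, it inherits a derivation from the entrywise
one. -/
theorem AzumayaAlg.exists_isDiffAlg (A : AzumayaAlg R) :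
    ∃ D : A.carrier →+ A.carrier, IsDiffAlg R D := by
  obtain ⟨B, N, -, ⟨e⟩⟩ := A.exists_tensor_equiv_matrix
  obtain ⟨l, hl⟩ := exists_linearMap_one_eq_one (R := R) B.carrier
  exact ((isDiffAlg_matrix (0 : Matrix (Fin N) (Fin N) R)).conj e.symm).exists_of_tensor hl

/-! ### The differential Brauer monoid modulo the matrix differential Brauer monoid -/

theorem MAdiff.forget_surjective : Function.Surjective (MAdiff.forget R) := by
  rintro ⟨A⟩
  obtain ⟨D, hD⟩ := A.exists_isDiffAlg
  exact ⟨MAdiff.mk ⟨A, D, hD⟩, rfl⟩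

theorem MAdiff.mk_mem_MMdiff {A : DiffAzumayaAlg R} {N : ℕ} (hN : 0 < N)
    (e : A.carrier ≃ₐ[R] Matrix (Fin N) (Fin N) R) : MAdiff.mk A ∈ MMdiff R := by
  obtain ⟨Z, hZ⟩ := (A.isDiffAlg.conj e).exists_eq_matrixDeriv
  refine ⟨N, ⟨hN.ne'⟩, Z, MAdiff.mk_eq_mk.2 ⟨e, fun a => ?_⟩⟩
  change e (A.D a) = matrixDeriv Z (e a)
  rw [← hZ]
  simp

/-- Every class in `MA^diff(R)` has an inverse modulo `MM^diff(R)`, which depends only on the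
underlying Azumaya algebra. -/
theorem MAdiff.exists_mul_mem_MMdiff (m : MA R) :
    ∃ z : MAdiff R, ∀ x : MAdiff R, MAdiff.forget R x = m → x * z ∈ MMdiff R := by
  obtain ⟨A⟩ := m
  obtain ⟨B, N, hN, ⟨e⟩⟩ := A.exists_tensor_equiv_matrix
  obtain ⟨D, hD⟩ := B.exists_isDiffAlg
  refine ⟨MAdiff.mk ⟨B, D, hD⟩, ?_⟩
  rintro ⟨A'⟩ h
  obtain ⟨e'⟩ := MA.mk_eq_mk.1 h
  exact MAdiff.mk_mem_MMdiff (A := A'.tensor ⟨B, D, hD⟩) hN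
    ((Algebra.TensorProduct.congr e' AlgEquiv.refl).trans e)

/-- With an inverse `z` of `x` and `y` modulo `MM^diff(R)`, both factors in
`x * (y * z) = y * (x * z)` lie in `MM^diff(R)`. -/
theorem MAdiff.exists_mul_eq_mul {x y : MAdiff R} (h : MAdiff.forget R x = MAdiff.forget R y) :
    ∃ a ∈ MMdiff R, ∃ b ∈ MMdiff R, x * a = y * b := by
  obtain ⟨z, hz⟩ := MAdiff.exists_mul_mem_MMdiff (MAdiff.forget R y)
  exact ⟨y * z, hz y rfl, x * z, hz x h, mul_left_comm x y z⟩

theorem MAdiff.forget_mem_MM {x : MAdiff R} (hx : x ∈ MMdiff R) : MAdiff.forget R x ∈ MM R := by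
  obtain ⟨n, hn, Z, rfl⟩ := hx
  exact ⟨n, hn, rfl⟩

theorem MAdiff.exists_mem_MM0diff {m : MA R} (hm : m ∈ MM R) :
    ∃ x ∈ MM0diff R, MAdiff.forget R x = m := by
  obtain ⟨n, hn, rfl⟩ := hm
  exact ⟨_, ⟨n, hn, rfl⟩, rfl⟩

theorem MM0diff_le_MMdiff : MM0diff R ≤ MMdiff R := by
  rintro _ ⟨n, hn, rfl⟩
  exact ⟨n, hn, 0, rfl⟩

theorem BMdiff.toBM_mk (x : MAdiff R) : BMdiff.toBM R (MonoidQuot.mk (MM0diff R) x) =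
    MonoidQuot.mk (MM R) (MAdiff.forget R x) := rfl

theorem BMdiff.toBM_surjective : Function.Surjective (BMdiff.toBM R) := by
  intro y
  obtain ⟨m, rfl⟩ := Con.mk'_surjective y
  obtain ⟨x, rfl⟩ := MAdiff.forget_surjective m
  exact ⟨MonoidQuot.mk (MM0diff R) x, rfl⟩

/-- The fibres of `BM^diff(R) → BM(R)` are the classes modulo `MBM^diff(R)`. An equality in `BM(R)`
lifts to differential algebras with equal underlying class because `MM₀^diff(R)` maps onto `MM(R)`. -/
theorem BMdiff.toBM_eq_iff (x y : BMdiff R) :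
    BMdiff.toBM R x = BMdiff.toBM R y ↔ quotCon (MBMdiff R) x y := by
  obtain ⟨x, rfl⟩ := Con.mk'_surjective x
  obtain ⟨y, rfl⟩ := Con.mk'_surjective y
  constructor
  · intro h
    obtain ⟨a, ha, b, hb, hab⟩ := (Con.eq _).1 h
    obtain ⟨a, ha₀, rfl⟩ := MAdiff.exists_mem_MM0diff ha
    obtain ⟨b, hb₀, rfl⟩ := MAdiff.exists_mem_MM0diff hb
    rw [← map_mul, ← map_mul] at hab
    obtain ⟨c, hc, d, hd, hcd⟩ := MAdiff.exists_mul_eq_mul hab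
    refine ⟨_, ⟨a * c, mul_mem (MM0diff_le_MMdiff ha₀) hc, rfl⟩,
      _, ⟨b * d, mul_mem (MM0diff_le_MMdiff hb₀) hd, rfl⟩, ?_⟩
    rw [← map_mul, ← map_mul, ← mul_assoc, ← mul_assoc, hcd]
  · rintro ⟨_, ⟨a, ha, rfl⟩, _, ⟨b, hb, rfl⟩, h⟩
    have h' := congrArg (BMdiff.toBM R) h
    have htriv : ∀ c ∈ MMdiff R, BMdiff.toBM R (MonoidQuot.mk (MM0diff R) c) = 1 := fun c hc =>
      (Con.eq _).2 ⟨1, one_mem _, _, MAdiff.forget_mem_MM hc, by rw [mul_one, one_mul]⟩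
    rwa [map_mul, map_mul, htriv a ha, htriv b hb, mul_one, mul_one] at h'

end Classes

end DiffBrauer

end

theorem mainTheorem2 (R : Type*) [CommRing R] [Differential R] :
    Function.Surjective (DiffBrauer.BMdiff.toBM R) ∧
    ∃ e : DiffBrauer.MonoidQuot (DiffBrauer.MBMdiff R) ≃* DiffBrauer.BM R,
      ∀ x : DiffBrauer.BMdiff R,
        e (DiffBrauer.MonoidQuot.mk (DiffBrauer.MBMdiff R) x) = DiffBrauer.BMdiff.toBM R x := by
  let φ : DiffBrauer.MonoidQuot (DiffBrauer.MBMdiff R) →* DiffBrauer.BM R :=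
    (DiffBrauer.quotCon (DiffBrauer.MBMdiff R)).lift (DiffBrauer.BMdiff.toBM R)
      fun x y h => (DiffBrauer.BMdiff.toBM_eq_iff x y).2 h
  have hφ : ∀ x, φ (DiffBrauer.MonoidQuot.mk (DiffBrauer.MBMdiff R) x) =
      DiffBrauer.BMdiff.toBM R x := fun _ => rfl
  have hbij : Function.Bijective φ := by
    refine ⟨fun x y h => ?_, fun y => ?_⟩
    · obtain ⟨x, rfl⟩ := Con.mk'_surjective x
      obtain ⟨y, rfl⟩ := Con.mk'_surjective y
      exact (Con.eq _).2 ((DiffBrauer.BMdiff.toBM_eq_iff x y).1 h)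
    · obtain ⟨x, rfl⟩ := DiffBrauer.BMdiff.toBM_surjective y
      exact ⟨_, hφ x⟩
  exact ⟨DiffBrauer.BMdiff.toBM_surjective, MulEquiv.ofBijective φ hbij, hφ⟩
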